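/- Let $k$ be a commutative ring and let $\mathfrak B$ be the commutative $k$-algebra generated by the letters $b(i)_j$, $i,j\in\mathbb Z$, modulo the quadratic relations $$\det\begin{pmatrix} b(1)_j & b(1)_l\\ b(j-1)_{i+j-l} & b(l-1)_i\end{pmatrix}-\det\begin{pmatrix} b(1)_j & b(j-1)_{j+l-1}\\ b(1)_{i-l+1} & b(l)_i\end{pmatrix}+\det\begin{pmatrix} b(1)_l & b(j)_{j+l-1}\\ b(1)_{i-l+1} & b(j)_{i+j-l}\end{pmatrix}=0\qquad(i,j,l\in\mathbb Z).$$ For $m\ge 2$ let $C(m)$ be the symmetric $(m-1)\times(m-1)$ matrix with entries $C(m)_{pq}=b(\min(p,q))_{p+q}$, $1\le p,q\le m-1$. For $i\in\mathbb Z$ let $C(m)_i$ be the matrix obtained from $C(m)$ by replacing its last row by $(b(1)_{m+i},\,b(2)_{m+i+1},\,\ldots,\,b(m-1)_{2m+i-2})$, so that $C(m)_0=C(m)$. Put $c(m)_i=\det C(m)_i$ and $c(m)=c(m)_0$. Then for all integers $n\ge 3$ and all $i\in\mathbb Z$ the following identity holds in $\mathfrak B$: $$c(n-1)_i\,c(n)^2-c(n-1)\,c(n)\,c(n)_i-c(n-1)_1\,c(n)_{i-1}\,c(n)+c(n-1)\,c(n)_1\,c(n)_{i-1}=-\,c(n-1)^2\,c(n+1)_{i-2}.$$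 -/

import Mathlib

namespace SturmB

/-- The polynomial ring `k[b(i)_j : i, j ∈ ℤ]` and its free letters `b(i)_j`, before
imposing relations. -/
noncomputable def letter (k : Type*) [CommRing k] (i j : ℤ) : MvPolynomial (ℤ × ℤ) k :=
  MvPolynomial.X (i, j)

/-- The quadratic relator `Δ(k,j)_i - Δ'(k,j)_i + Δ''(k,j)_i`, with `l` in the role of the
integer index `k` (the name `k` is used for the base ring). -/
noncomputable def relator (k : Type*) [CommRing k] (i j l : ℤ) : MvPolynomial (ℤ × ℤ) k :=
  Matrix.det !![letter k 1 j, letter k 1 l;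
                letter k (j - 1) (i + j - l), letter k (l - 1) i]
  - Matrix.det !![letter k 1 j, letter k (j - 1) (j + l - 1);
                  letter k 1 (i - l + 1), letter k l i]
  + Matrix.det !![letter k 1 l, letter k j (j + l - 1);
                  letter k 1 (i - l + 1), letter k j (i + j - l)]

/-- The ideal generated by all the quadratic relators, `i, j, l ∈ ℤ`. -/
noncomputable def relIdeal (k : Type*) [CommRing k] : Ideal (MvPolynomial (ℤ × ℤ) k) :=
  Ideal.span {r | ∃ i j l : ℤ, r = relator k i j l}

/-- The quadratic algebra `𝔅` over `k`. -/
abbrev QuadAlg (k : Type*) [CommRing k] : Type _ :=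
  MvPolynomial (ℤ × ℤ) k ⧸ relIdeal k

/-- The generator `b(i)_j` of `𝔅`. -/
noncomputable def b (k : Type*) [CommRing k] (i j : ℤ) : QuadAlg k :=
  Ideal.Quotient.mk (relIdeal k) (letter k i j)

/-- The symmetric `(m-1) × (m-1)` matrix `C(m)`, `m ≥ 2`. In 1-based indices its `(p,q)` entry
is `b(min(p,q))_{p+q}`; the indices of `Fin (m - 1)` start at `0`. -/
noncomputable def matC (k : Type*) [CommRing k] (m : ℕ) :
    Matrix (Fin (m - 1)) (Fin (m - 1)) (QuadAlg k) :=
  Matrix.of fun p q => b k (min (p : ℤ) (q : ℤ) + 1) ((p : ℤ) + (q : ℤ) + 2)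

/-- The shifted matrix `C(m)_i`: the last row of `C(m)` is replaced by
`(b(1)_{m+i}, b(2)_{m+i+1}, …, b(m-1)_{2m+i-2})`. -/
noncomputable def matCShift (k : Type*) [CommRing k] (m : ℕ) (i : ℤ) :
    Matrix (Fin (m - 1)) (Fin (m - 1)) (QuadAlg k) :=
  Matrix.of fun p q =>
    if (p : ℕ) + 1 = m - 1 then b k ((q : ℤ) + 1) ((m : ℤ) + i + (q : ℤ)) else matC k m p q

/-- `C(m)_0 = C(m)`. -/
theorem matCShift_zero (k : Type*) [CommRing k] (m : ℕ) : matCShift k m 0 = matC k m := by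
  ext p q
  have hp := p.isLt
  have hq := q.isLt
  simp only [matCShift, matC, Matrix.of_apply]
  split_ifs with h
  · congr 1 <;> omega
  · rfl

/-- `c(m)_i = det C(m)_i`. -/
noncomputable def cShift (k : Type*) [CommRing k] (m : ℕ) (i : ℤ) : QuadAlg k :=
  (matCShift k m i).det

/-- `c(m) = c(m)_0`. -/
noncomputable def c (k : Type*) [CommRing k] (m : ℕ) : QuadAlg k :=
  cShift k m 0

end SturmB

/-!
Write `n = m + 3`, let `C` be the infinite symmetric matrix whose leading blocks are the `C(m)`, and
for `t : ℤ` let `x_t` be the row with entries `b(q)_{t+q}`. Then `c(n)_i` is the determinant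
`D_n(t)` of a leading block of `C` whose last row is replaced by the part of `x_t` in its columns,
with `t = n - 1 + i`. With `t = n - 2 + i` the claim becomes a relation between
`D_{n-1}(t)`, `D_n(t)`, `D_n(t + 1)` and `D_{n+1}(t)`. It is a combination of three identities.

* Two instances of the three-term Plücker relation for maximal minors
  (`det_bordered_succ_mul` and `det_leading_mul_det_bordered`). They express `D_{n+1}(t)` and
  `D_{n-1}(t)` through `D_n(t)` and two further minors `G(t)` (last column moved by one,
  `skipCol`) and `H(t)` (last row of `C` moved by one, `skipRow`).
* The shift identity `D_n(t + 1) = G(t) - H(t)` (`det_bordered_rowAt_add_one`). The sum of the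
  determinants in which one column is shifted is `G(t)`, the sum of those in which one row is
  shifted is `H(t) + D_n(t + 1)`. Their difference is the derivative of the determinant in the
  direction of the matrix with entries `C_{p,q+1} - C_{p+1,q}`, as `det_bordered_shift` says.

The relations of `𝔅` enter only there. With `a_j = b(1)_j` and
`E(l,m) = b(l)_{l+m-1} - b(l-1)_{l+m-1}` they say `a_j E(l,m) - a_l E(j,m) + a_m E(j,l) = 0`, and
the entries of the difference matrix are `0` or of the form `± E`: the matrix `C` behaves like a
Bezoutian. Since the first row and column of `C` consist of the `a_j`, expanding the minors along
them makes the derivative vanish (`sum_det_updateRow_eq_zero`). Nothing is cancelled, which matters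
because `𝔅` has zero divisors, such as the `E(j,j)`, which are killed by every `a_m`.
-/

namespace SturmB

section Determinants

variable {R : Type*} [CommRing R]

/-! ### Determinants with replaced rows and columns -/

section

variable {n : Type*} [DecidableEq n] [Fintype n]

theorem det_updateRow_eq_sum_adjugate (M : Matrix n n R) (p : n) (v : n → R) :
    (M.updateRow p v).det = ∑ q, v q * M.adjugate q p := by
  rw [← Matrix.cramer_transpose_apply, Matrix.cramer_eq_adjugate_mulVec,
    ← Matrix.adjugate_transpose]
  simp [Matrix.mulVec, dotProduct, mul_comm]

theorem det_updateCol_eq_sum_adjugate (M : Matrix n n R) (q : n) (v : n → R) :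
    (M.updateCol q v).det = ∑ p, v p * M.adjugate q p := by
  rw [← Matrix.cramer_apply, Matrix.cramer_eq_adjugate_mulVec]
  simp [Matrix.mulVec, dotProduct, mul_comm]

/-- Cramer's rule: the expansion of a vector in the rows of a matrix. -/
theorem det_mul_eq_sum_det_updateRow_mul (M : Matrix n n R) (v : n → R) (q : n) :
    M.det * v q = ∑ p, (M.updateRow p v).det * M p q := by
  have h := congrFun (Matrix.mulVec_cramer M.transpose v) q
  simp only [Matrix.mulVec, dotProduct, Matrix.cramer_transpose_apply, Matrix.transpose_apply,
    Matrix.det_transpose, Pi.smul_apply, smul_eq_mul] at h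
  rw [← h]
  exact Finset.sum_congr rfl fun p _ => mul_comm _ _

/-- The three-term Plücker relation: with `A` the rows of `M` other than `u = M i` and `v = M j`,
it reads `[A,u,v] [A,x,y] = [A,x,v] [A,u,y] + [A,u,x] [A,v,y]`. It follows by applying the linear
form `w ↦ [A,w,y]` to Cramer's expansion of `x` in the rows of `M`. -/
theorem det_mul_det_updateRow_updateRow (M : Matrix n n R) {i j : n} (hij : i ≠ j) (x y : n → R) :
    M.det * ((M.updateRow i x).updateRow j y).det =
      (M.updateRow i x).det * (M.updateRow j y).det
        + (M.updateRow j x).det * ((M.updateRow i (M j)).updateRow j y).det := by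
  have key : ∀ v : n → R, ((M.updateRow i v).updateRow j y).det
      = ∑ q, v q * (M.updateRow j y).adjugate q i := fun v => by
    rw [Matrix.updateRow_comm _ hij, det_updateRow_eq_sum_adjugate]
  have hp : ∀ p, ((M.updateRow i (M p)).updateRow j y).det =
    if p = i then (M.updateRow j y).det else if p = j then
      ((M.updateRow i (M j)).updateRow j y).det else 0 := fun p => by
    split_ifs with h1 h2
    · rw [h1, Matrix.updateRow_eq_self]
    · rw [h2]
    · refine Matrix.det_zero_of_row_eq h1 ?_
      simp [Matrix.updateRow_ne, h1, h2, hij]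
  have h : M.det * ((M.updateRow i x).updateRow j y).det =
      ∑ p, (M.updateRow p x).det * ((M.updateRow i (M p)).updateRow j y).det := by
    simp_rw [key, Finset.mul_sum, ← mul_assoc, det_mul_eq_sum_det_updateRow_mul M x, Finset.sum_mul]
    exact Finset.sum_comm
  rw [h]
  rw [Finset.sum_eq_add i j hij]
  · rw [hp, hp, if_pos rfl, if_neg hij.symm, if_pos rfl]
  · rintro p - ⟨h1, h2⟩
    rw [hp, if_neg h1, if_neg h2, mul_zero]
  · simp
  · simp

theorem det_updateRow_updateRow_swap (M : Matrix n n R) {i j : n} (hij : i ≠ j) (x y : n → R) :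
    ((M.updateRow i x).updateRow j y).det = -((M.updateRow i y).updateRow j x).det := by
  have h : ((M.updateRow i (x + y)).updateRow j (x + y)).det = 0 :=
    Matrix.det_zero_of_row_eq hij (by simp [Matrix.updateRow_ne hij])
  have hd : ∀ z : n → R, ((M.updateRow i z).updateRow j z).det = 0 := fun z =>
    Matrix.det_zero_of_row_eq hij (by simp [Matrix.updateRow_ne hij])
  rw [Matrix.det_updateRow_add, Matrix.updateRow_comm _ hij, Matrix.updateRow_comm _ hij,
    Matrix.det_updateRow_add, Matrix.det_updateRow_add, Matrix.updateRow_comm _ hij.symm,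
    Matrix.updateRow_comm _ hij.symm, Matrix.updateRow_comm _ hij.symm,
    Matrix.updateRow_comm _ hij.symm, hd, hd] at h
  linear_combination h

theorem sum_sum_mul_of_alternating {m : Type*} [Fintype m] [LinearOrder m] (x y : m → R)
    (w : m → m → R) (h0 : ∀ j, w j j = 0) (hs : ∀ j q, w j q = -w q j) :
    ∑ j, ∑ q, x j * y q * w j q =
      ∑ j, ∑ q, if j < q then (x j * y q - x q * y j) * w j q else 0 := by
  have : ∀ j q, x j * y q * w j q = (if j < q then x j * y q * w j q else 0) +
      (if q < j then x j * y q * w j q else 0) := by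
    intro j q
    rcases lt_trichotomy j q with h | h | h
    · simp [h, h.not_gt]
    · subst h; simp [h0]
    · simp [h, h.not_gt]
  rw [Finset.sum_congr rfl fun j _ => Finset.sum_congr rfl fun q _ => this j q]
  simp only [Finset.sum_add_distrib]
  rw [Finset.sum_comm (f := fun j q => if q < j then x j * y q * w j q else 0),
    ← Finset.sum_add_distrib]
  refine Finset.sum_congr rfl fun j _ => ?_
  rw [← Finset.sum_add_distrib]
  refine Finset.sum_congr rfl fun q _ => ?_
  split_ifs
  · rw [hs q j]; ring
  · simp

end

/-! ### Vanishing of a derivative of the determinant -/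

/-- Let `α` be the first row and `β` the first column of `M`. If every row `F p`, `p ≠ 0`, satisfies
`α ∧ F p = -β p • G` and the first row of `F` is `-G 0`, with `F 0 0 = 0`,
then the derivative of `det` at `M` in the direction `F` vanishes. The hypotheses give the
conclusion times each `α j` by Cramer's rule; to avoid a division the minors are expanded
along the first row, so that only `α ∧ F p` enters. -/
theorem sum_det_updateRow_eq_zero {m : ℕ} (M F : Matrix (Fin (m + 1)) (Fin (m + 1)) R)
    (G : Fin (m + 1) → Fin (m + 1) → R) (h00 : F 0 0 = 0) (h0 : ∀ q, 0 < q → F 0 q = -G 0 q)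
    (hF : ∀ p, p ≠ 0 → ∀ j q, j < q →
      M 0 j * F p q - M 0 q * F p j = -(M p 0 * G j q)) :
    ∑ p, (M.updateRow p (F p)).det = 0 := by
  -- `w p` is the alternating bilinear form of the pair of rows `0` and `p`.
  set w : Fin (m + 1) → Fin (m + 1) → Fin (m + 1) → R := fun p j q =>
    ((M.updateRow 0 (Pi.single j 1)).updateRow p (Pi.single q 1)).det with hw
  have hrow : ∀ p, p ≠ 0 → (M.updateRow p (F p)).det = ∑ j, ∑ q, M 0 j * F p q * w p j q := by
    intro p hp
    calc (M.updateRow p (F p)).det = ((M.updateRow p (F p)).updateRow 0 (M 0)).det := by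
          conv_rhs => rw [Matrix.updateRow_comm _ hp, Matrix.updateRow_eq_self]
      _ = ∑ j, M 0 j * ((M.updateRow 0 (Pi.single j 1)).updateRow p (F p)).det := by
          rw [det_updateRow_eq_sum_adjugate]
          simp_rw [Matrix.adjugate_apply, Matrix.updateRow_comm _ hp]
      _ = _ := by
          simp_rw [det_updateRow_eq_sum_adjugate (M.updateRow 0 _) p, Finset.mul_sum, hw,
            Matrix.adjugate_apply, mul_assoc]
  have hdiag : ∀ p, p ≠ 0 → ∀ j, w p j j = 0 := fun p hp j =>
    Matrix.det_zero_of_row_eq hp (by simp [hp.symm])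
  have hswap : ∀ p, p ≠ 0 → ∀ j q, w p j q = -w p q j := fun p hp j q =>
    det_updateRow_updateRow_swap M hp.symm _ _
  -- Expand along column `q` with the first column `β` put there: it cancels against column `0`
  -- except in the entry of row `0`.
  have hcol : ∀ j q, j < q → ∑ p : Fin m, M p.succ 0 * w p.succ j q
      = if j = 0 then -(M.updateRow 0 (Pi.single q 1)).det else 0 := by
    intro j q hjq
    have hq : q ≠ 0 := (lt_of_le_of_lt (Fin.zero_le j) hjq).ne'
    have h1 := det_updateCol_eq_sum_adjugate (M.updateRow 0 (Pi.single j 1)) q (fun p => M p 0)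
    have h2 : (fun p => M p 0) = (fun p => (M.updateRow 0 (Pi.single j 1)) p 0) +
        (M 0 0 - (Pi.single j 1 : Fin (m + 1) → R) 0) • (Pi.single 0 1 : Fin (m + 1) → R) := by
      ext p
      by_cases hp : p = 0
      · subst hp; simp
      · simp [hp]
    have h3 : ((M.updateRow 0 (Pi.single j 1)).updateCol q (Pi.single 0 1)).det =
        (M.updateRow 0 (Pi.single q 1)).det := by
      rw [det_updateCol_eq_sum_adjugate]
      simp [Pi.single_apply, Matrix.adjugate_apply]
    have h4 : ((M.updateRow 0 (Pi.single j 1)).updateCol q (fun p => M p 0)).det =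
        (M 0 0 - (Pi.single j 1 : Fin (m + 1) → R) 0) * (M.updateRow 0 (Pi.single q 1)).det := by
      rw [h2, Matrix.det_updateCol_add, Matrix.det_updateCol_smul, h3,
        Matrix.det_zero_of_column_eq (i := 0) (j := q) hq.symm (by simp [hq.symm]), zero_add]
    rw [h4, Fin.sum_univ_succ] at h1
    simp only [Matrix.adjugate_apply, Matrix.updateRow_idem] at h1
    rw [Pi.single_apply] at h1
    split_ifs with hj
    · rw [if_pos hj.symm] at h1
      linear_combination -h1
    · rw [if_neg (Ne.symm hj)] at h1
      linear_combination -h1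
  have hsucc : ∑ p : Fin m, (M.updateRow p.succ (F p.succ)).det =
      ∑ q, if 0 < q then G 0 q * (M.updateRow 0 (Pi.single q 1)).det else 0 := by
    calc _ = ∑ p : Fin m, ∑ j, ∑ q,
            if j < q then -(G j q * (M p.succ 0 * w p.succ j q)) else 0 := by
          refine Finset.sum_congr rfl fun p _ => ?_
          rw [hrow _ (Fin.succ_ne_zero p), sum_sum_mul_of_alternating _ _ _
            (hdiag _ (Fin.succ_ne_zero p)) (hswap _ (Fin.succ_ne_zero p))]
          refine Finset.sum_congr rfl fun j _ => Finset.sum_congr rfl fun q _ => ?_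
          split_ifs with hjq
          · rw [hF _ (Fin.succ_ne_zero p) j q hjq]; ring
          · rfl
      _ = ∑ j, ∑ q, if j < q then
            -(G j q * if j = 0 then -(M.updateRow 0 (Pi.single q 1)).det else 0) else 0 := by
          rw [Finset.sum_comm]
          refine Finset.sum_congr rfl fun j _ => ?_
          rw [Finset.sum_comm]
          refine Finset.sum_congr rfl fun q _ => ?_
          split_ifs with hjq h0
          · rw [Finset.sum_neg_distrib, ← Finset.mul_sum, hcol j q hjq, if_pos h0]
          · rw [Finset.sum_neg_distrib, ← Finset.mul_sum, hcol j q hjq, if_neg h0]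
          · simp
      _ = _ := by
          rw [Finset.sum_eq_single 0]
          · simp
          · intro j _ hj
            simp [hj]
          · simp
  rw [Fin.sum_univ_succ, hsucc, det_updateRow_eq_sum_adjugate, ← Finset.sum_add_distrib]
  refine Finset.sum_eq_zero fun q _ => ?_
  rw [Matrix.adjugate_apply]
  split_ifs with hq
  · rw [h0 q hq]; ring
  · rw [show q = 0 from le_antisymm (not_lt.mp hq) (Fin.zero_le q), h00]; ring

/-! ### Minors of an infinite matrix -/

/-- The leading `m × m` block of an infinite matrix. -/
def leading (m : ℕ) (C : ℕ → ℕ → R) : Matrix (Fin m) (Fin m) R :=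
  Matrix.of fun p q => C p q

/-- The leading `(m + 1) × (m + 1)` block of `C`, with its last row replaced by `x`. -/
def bordered (m : ℕ) (C : ℕ → ℕ → R) (x : ℕ → R) : Matrix (Fin (m + 1)) (Fin (m + 1)) R :=
  (leading (m + 1) C).updateRow (Fin.last m) fun q => x q

theorem det_updateRow_single {m : ℕ} (A : Matrix (Fin (m + 1)) (Fin (m + 1)) R)
    (i j : Fin (m + 1)) :
    (A.updateRow i (Pi.single j 1)).det =
      (-1) ^ (i + j : ℕ) * (A.submatrix i.succAbove j.succAbove).det := by
  rw [← Matrix.adjugate_apply, Matrix.adjugate_fin_succ_eq_det_submatrix]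

theorem det_updateRow_last_single {m : ℕ} (A : Matrix (Fin (m + 1)) (Fin (m + 1)) R) :
    (A.updateRow (Fin.last m) (Pi.single (Fin.last m) 1)).det =
      (A.submatrix Fin.castSucc Fin.castSucc).det := by
  rw [det_updateRow_single, Fin.succAbove_last, Even.neg_one_pow ⟨_, rfl⟩, one_mul]

theorem bordered_self {S : Type*} (m : ℕ) (C : ℕ → ℕ → S) :
    bordered m C (C m) = leading (m + 1) C := by
  rw [bordered]
  exact Matrix.updateRow_eq_self _ (Fin.last m)

theorem val_succAbove_castSucc_last {m : ℕ} (p : Fin (m + 1)) :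
    (((Fin.last m).castSucc.succAbove p : Fin (m + 2)) : ℕ) =
      if p = Fin.last m then m + 1 else p := by
  induction p using Fin.lastCases with
  | last => simp
  | cast p =>
    rw [Fin.succAbove_of_castSucc_lt _ _ (by simp [Fin.castSucc_lt_last])]
    simp [(Fin.castSucc_lt_last p).ne]

/-- Rows `0, …, m - 1` of `C` and `x`, in the columns `0, …, m - 1` and `m + 1`. -/
def skipCol (m : ℕ) (C : ℕ → ℕ → R) (x : ℕ → R) : Matrix (Fin (m + 1)) (Fin (m + 1)) R :=
  (bordered m C x).updateCol (Fin.last m) fun p =>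
    if p = Fin.last m then x (m + 1) else C p (m + 1)

/-- Rows `0, …, m - 1` and `m + 1` of `C` and `x`, in the columns `0, …, m + 1`. -/
def skipRow (m : ℕ) (C : ℕ → ℕ → R) (x : ℕ → R) : Matrix (Fin (m + 2)) (Fin (m + 2)) R :=
  (bordered (m + 1) C x).updateRow (Fin.last m).castSucc fun q => C (m + 1) q

/-- Plücker relation for the last two rows and the unit vectors of the last two columns. The
symmetry of `C` turns the minor without row and column `m + 1` of `C` into a bordered one. -/
theorem det_bordered_succ_mul (m : ℕ) (C : ℕ → ℕ → R) (hC : ∀ p q, C p q = C q p) (x : ℕ → R) :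
    (bordered (m + 2) C x).det * (leading (m + 1) C).det =
      (leading (m + 2) C).det * (skipCol (m + 1) C x).det
        - (bordered (m + 1) C (C (m + 2))).det * (bordered (m + 1) C x).det := by
  have hne : (Fin.last (m + 1)).castSucc ≠ Fin.last (m + 2) := (Fin.castSucc_lt_last _).ne
  have h := det_mul_det_updateRow_updateRow (bordered (m + 2) C x) hne
    (Pi.single (Fin.last (m + 1)).castSucc 1) (Pi.single (Fin.last (m + 2)) 1)
  rw [det_updateRow_last_single, det_updateRow_last_single, det_updateRow_last_single,
    det_updateRow_single _ (Fin.last (m + 1)).castSucc,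
    det_updateRow_single _ (Fin.last (m + 2))] at h
  have e1 : (((bordered (m + 2) C x).updateRow (Fin.last (m + 1)).castSucc
      (Pi.single (Fin.last (m + 1)).castSucc 1)).submatrix Fin.castSucc Fin.castSucc).det =
      (leading (m + 1) C).det := by
    have : ((bordered (m + 2) C x).updateRow (Fin.last (m + 1)).castSucc
      (Pi.single (Fin.last (m + 1)).castSucc 1)).submatrix Fin.castSucc Fin.castSucc
      = (leading (m + 2) C).updateRow (Fin.last (m + 1)) (Pi.single (Fin.last (m + 1)) 1) := by
      ext p q
      induction p using Fin.lastCases with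
      | last => simp [Pi.single_apply]
      | cast p => simp [Matrix.updateRow_apply, bordered, leading]
    rw [this, det_updateRow_last_single]
    rfl
  have e2 : (bordered (m + 2) C x).submatrix Fin.castSucc Fin.castSucc = leading (m + 2) C := by
    ext p q
    simp [Matrix.updateRow_apply, bordered, leading]
  have e3 : ((bordered (m + 2) C x).updateRow (Fin.last (m + 1)).castSucc
      (bordered (m + 2) C x (Fin.last (m + 2)))).submatrix Fin.castSucc Fin.castSucc
      = bordered (m + 1) C x := by
    ext p q
    simp [Matrix.updateRow_apply, bordered, leading]
  have e4 : (bordered (m + 2) C x).submatrix (Fin.last (m + 1)).castSucc.succAbove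
      (Fin.last (m + 1)).castSucc.succAbove = skipCol (m + 1) C x := by
    ext p q
    simp only [Matrix.submatrix_apply, skipCol, bordered, Matrix.updateRow_apply, leading,
      Matrix.of_apply, Matrix.updateCol_apply, val_succAbove_castSucc_last, Fin.ext_iff,
      Fin.val_last]
    have hp := p.isLt
    split_ifs <;> first | omega | simp_all
  have e5 : ((bordered (m + 2) C x).submatrix (Fin.last (m + 2)).succAbove
      (Fin.last (m + 1)).castSucc.succAbove).transpose = bordered (m + 1) C (C (m + 2)) := by
    ext p q
    simp only [Matrix.transpose_apply, Matrix.submatrix_apply, bordered, Matrix.updateRow_apply,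
      leading, Matrix.of_apply, val_succAbove_castSucc_last, Fin.succAbove_last, Fin.val_castSucc,
      (Fin.castSucc_lt_last q).ne, if_false]
    split_ifs <;> exact hC _ _
  rw [e1, e2, e3, e4,
    ← Matrix.det_transpose (Matrix.submatrix _ (Fin.last (m + 2)).succAbove _), e5] at h
  simp only [Fin.val_castSucc, Fin.val_last] at h
  rw [Even.neg_one_pow ⟨_, rfl⟩, Odd.neg_one_pow ⟨m + 1, by ring⟩] at h
  linear_combination h

/-- Plücker relation for the last two rows, `x`, and the unit vector of the last column. -/
theorem det_leading_mul_det_bordered (m : ℕ) (C : ℕ → ℕ → R) (x : ℕ → R) :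
    (leading (m + 2) C).det * (bordered m C x).det =
      (bordered (m + 1) C x).det * (bordered m C (C (m + 1))).det
        - (skipRow m C x).det * (leading (m + 1) C).det := by
  have hne : (Fin.last m).castSucc ≠ Fin.last (m + 1) := (Fin.castSucc_lt_last _).ne
  have h := det_mul_det_updateRow_updateRow (leading (m + 2) C) hne (fun q => x q)
    (Pi.single (Fin.last (m + 1)) 1)
  have e0 : ((leading (m + 2) C).updateRow (Fin.last m).castSucc fun q => x q).det =
      -(skipRow m C x).det := by
    conv_lhs => rw [← Matrix.updateRow_eq_self (Matrix.updateRow _ _ _) (Fin.last (m + 1)),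
      Matrix.updateRow_ne hne.symm]
    rw [det_updateRow_updateRow_swap _ hne, skipRow, bordered, Matrix.updateRow_comm _ hne]
    rfl
  have e1 : ∀ y : ℕ → R,
      ((leading (m + 2) C).updateRow (Fin.last m).castSucc fun q => y q).submatrix
        Fin.castSucc Fin.castSucc = bordered m C y := fun y => by
    ext p q
    simp [Matrix.updateRow_apply, bordered, leading]
  have e2 : (leading (m + 2) C).submatrix Fin.castSucc Fin.castSucc = leading (m + 1) C := rfl
  rw [det_updateRow_last_single, det_updateRow_last_single, det_updateRow_last_single,
    e0, e1, e2] at h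
  have e3 := e1 (C (m + 1))
  rw [show leading (m + 2) C (Fin.last (m + 1)) = fun q : Fin (m + 2) => C (m + 1) q from rfl,
    e3] at h
  have e4 : (leading (m + 2) C).updateRow (Fin.last (m + 1)) (fun q => x q) =
      bordered (m + 1) C x := rfl
  rw [h, e4]
  ring

/-- The sum of the determinants in which one row is replaced by its successor equals the sum of
those in which one column is replaced by its successor, if the derivative of `det` vanishes in the
direction of the difference. Here `x'` is the successor of `x`. Only the shifts of the last column
and of the last two rows do not repeat a column or a row. -/
theorem det_bordered_shift (m : ℕ) (C : ℕ → ℕ → R) (x x' : ℕ → R)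
    (h : ∑ p, ((bordered (m + 1) C x).updateRow p fun q => if p = Fin.last (m + 1) then
      x (q + 1) - x' q else C p (q + 1) - C (p + 1) q).det = 0) :
    (bordered (m + 1) C x').det = (skipCol (m + 1) C x).det - (skipRow m C x).det := by
  set M := bordered (m + 1) C x with hM
  set P : Matrix (Fin (m + 2)) (Fin (m + 2)) R := fun p q => if p = Fin.last (m + 1) then
    x (q + 1) else C p (q + 1) with hP
  set Q : Matrix (Fin (m + 2)) (Fin (m + 2)) R := fun p q => if p = Fin.last (m + 1) then
    x' q else C (p + 1) q with hQ
  have h1 : ∑ p, (M.updateRow p (P p)).det = ∑ p, (M.updateRow p (Q p)).det := by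
    rw [← sub_eq_zero, ← Finset.sum_sub_distrib, ← h]
    refine Finset.sum_congr rfl fun p _ => ?_
    rw [det_updateRow_eq_sum_adjugate, det_updateRow_eq_sum_adjugate,
      det_updateRow_eq_sum_adjugate, ← Finset.sum_sub_distrib]
    refine Finset.sum_congr rfl fun q _ => ?_
    simp only [hP, hQ]
    split_ifs <;> ring
  have h2 : ∑ p, (M.updateRow p (P p)).det = ∑ q, (M.updateCol q fun p => P p q).det := by
    simp_rw [det_updateRow_eq_sum_adjugate, det_updateCol_eq_sum_adjugate]
    exact Finset.sum_comm
  have h3 : ∑ q, (M.updateCol q fun p => P p q).det = (skipCol (m + 1) C x).det := by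
    rw [Fin.sum_univ_castSucc, Finset.sum_eq_zero, zero_add]
    · rfl
    · intro q _
      have hne : q.castSucc ≠ q.succ := (Fin.castSucc_lt_succ).ne
      refine Matrix.det_zero_of_column_eq hne fun p => ?_
      rw [Matrix.updateCol_self, Matrix.updateCol_ne hne.symm]
      simp only [hP, hM, bordered, leading, Matrix.updateRow_apply, Matrix.of_apply,
        Fin.val_castSucc, Fin.val_succ]
  have h4 : ∑ p, (M.updateRow p (Q p)).det =
      (skipRow m C x).det + (bordered (m + 1) C x').det := by
    rw [Fin.sum_univ_castSucc, Fin.sum_univ_castSucc, Finset.sum_eq_zero, zero_add]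
    · congr 2
      · simp only [skipRow, hQ, (Fin.castSucc_lt_last _).ne, if_false]
        rfl
      · simp only [hM, bordered, hQ, if_true, Matrix.updateRow_idem]
    · intro p _
      have hne : p.castSucc.castSucc ≠ p.succ.castSucc := by simp [Fin.ext_iff]
      refine Matrix.det_zero_of_row_eq hne ?_
      rw [Matrix.updateRow_self, Matrix.updateRow_ne hne.symm]
      ext q
      simp [hQ, hM, bordered, leading, Matrix.updateRow_apply, (Fin.castSucc_lt_last _).ne]
  linear_combination h2 + h3 - h1 - h4

end Determinants

/-! ### The shift identity in the quadratic algebra -/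

variable (k : Type*) [CommRing k]

/-- The infinite matrix whose leading blocks are the matrices `C(m)`, indexed from `0`. -/
noncomputable def symMat (p q : ℕ) : QuadAlg k :=
  b k (min (p : ℤ) q + 1) (p + q + 2)

/-- The row `(b(1)_{t+1}, b(2)_{t+2}, …)`. On and below the diagonal, row `p` of `symMat` (counted
from `0`) is `rowAt (p + 1)`. -/
noncomputable def rowAt (t : ℤ) (q : ℕ) : QuadAlg k :=
  b k (q + 1) (t + q + 1)

/-- The difference `E(l,m) = b(l)_{l+m-1} - b(l-1)_{l+m-1}`. -/
noncomputable def jump (l m : ℤ) : QuadAlg k :=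
  b k l (l + m - 1) - b k (l - 1) (l + m - 1)

/-- The defining relations of the quadratic algebra, solved for differences: `a ∧ E = 0`. -/
theorem b_one_mul_jump (j l m : ℤ) :
    b k 1 j * jump k l m - b k 1 l * jump k j m + b k 1 m * jump k j l = 0 := by
  have h : Ideal.Quotient.mk (relIdeal k) (relator k (l + m - 1) j l) = 0 :=
    Ideal.Quotient.eq_zero_iff_mem.mpr (Ideal.subset_span ⟨_, _, _, rfl⟩)
  simp only [relator, Matrix.det_fin_two_of, map_sub, map_add, map_mul] at h
  rw [show l + m - 1 + j - l = j + m - 1 by ring, show l + m - 1 - l + 1 = m by ring] at h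
  simp only [jump, b]
  linear_combination -h

theorem symMat_comm (p q : ℕ) : symMat k p q = symMat k q p := by
  rw [symMat, symMat, min_comm, add_comm (p : ℤ)]

theorem symMat_eq_rowAt {p q : ℕ} (h : q ≤ p) : symMat k p q = rowAt k (p + 1) q := by
  rw [symMat, rowAt, min_eq_right (by exact_mod_cast h)]
  congr 1
  ring

theorem symMat_zero_left (q : ℕ) : symMat k 0 q = b k 1 (q + 2) := by
  simp [symMat]

theorem symMat_zero_right (p : ℕ) : symMat k p 0 = b k 1 (p + 2) := by
  rw [symMat_comm, symMat_zero_left]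

theorem symMat_sub_of_lt {p q : ℕ} (h : q < p) :
    symMat k p (q + 1) - symMat k (p + 1) q = jump k (q + 2) (p + 2) := by
  rw [symMat_eq_rowAt k (by omega), symMat_eq_rowAt k (by omega), rowAt, rowAt, jump]
  push_cast
  congr 2 <;> ring

theorem symMat_sub_self (p : ℕ) : symMat k p (p + 1) - symMat k (p + 1) p = 0 := by
  rw [symMat_comm, sub_self]

theorem symMat_sub_of_gt {p q : ℕ} (h : p < q) :
    symMat k p (q + 1) - symMat k (p + 1) q = -jump k (p + 2) (q + 2) := by
  rw [← symMat_sub_of_lt k h, symMat_comm k p, symMat_comm k (p + 1), neg_sub]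

theorem rowAt_sub (t : ℤ) (q : ℕ) :
    rowAt k t (q + 1) - rowAt k (t + 1) q = jump k (q + 2) (t + 1) := by
  rw [rowAt, rowAt, jump]
  push_cast
  congr 2 <;> ring

/-- The relations of the quadratic algebra for the antisymmetrised differences. -/
theorem b_one_mul_symMat_sub (p : ℕ) {j q : ℕ} (h : j < q) :
    b k 1 (j + 2) * (symMat k p (q + 1) - symMat k (p + 1) q)
      - b k 1 (q + 2) * (symMat k p (j + 1) - symMat k (p + 1) j) =
      -(b k 1 (p + 2) * jump k (j + 2) (q + 2)) := by
  rcases lt_trichotomy p j with hj | rfl | hj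
  · rw [symMat_sub_of_gt k hj, symMat_sub_of_gt k (hj.trans h)]
    linear_combination b_one_mul_jump k (p + 2) (j + 2) (q + 2)
  · rw [symMat_sub_self, symMat_sub_of_gt k h]
    ring
  rcases lt_trichotomy p q with hq | rfl | hq
  · rw [symMat_sub_of_lt k hj, symMat_sub_of_gt k hq]
    linear_combination -b_one_mul_jump k (j + 2) (p + 2) (q + 2)
  · rw [symMat_sub_self, symMat_sub_of_lt k h]
    ring
  · rw [symMat_sub_of_lt k hj, symMat_sub_of_lt k hq]
    linear_combination b_one_mul_jump k (j + 2) (q + 2) (p + 2)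

theorem det_bordered_rowAt_add_one (m : ℕ) (t : ℤ) :
    (bordered (m + 1) (symMat k) (rowAt k (t + 1))).det =
      (skipCol (m + 1) (symMat k) (rowAt k t)).det -
        (skipRow m (symMat k) (rowAt k t)).det := by
  have hlast : (0 : Fin (m + 2)) ≠ Fin.last (m + 1) := Fin.last_pos.ne
  have h0 : ∀ q : Fin (m + 2), bordered (m + 1) (symMat k) (rowAt k t) 0 q = b k 1 (q + 2) :=
    fun q => by
      rw [bordered, Matrix.updateRow_ne hlast]
      exact symMat_zero_left k q
  refine det_bordered_shift m _ _ _ (sum_det_updateRow_eq_zero _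
    (fun p q : Fin (m + 2) => if p = Fin.last (m + 1) then rowAt k t (q + 1) - rowAt k (t + 1) q
      else symMat k p (q + 1) - symMat k (p + 1) q)
    (fun j q => jump k ((j : ℕ) + 2) ((q : ℕ) + 2)) ?_ ?_ ?_)
  · simpa [hlast] using symMat_sub_self k 0
  · intro q hq
    simpa [hlast] using symMat_sub_of_gt k (p := 0) (q := q) hq
  · intro p _ j q hjq
    rw [h0, h0]
    split_ifs with hp
    · have hM : bordered (m + 1) (symMat k) (rowAt k t) p 0 = b k 1 (t + 1) := by
        rw [hp, bordered, Matrix.updateRow_self]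
        simp [rowAt]
      rw [hM, rowAt_sub, rowAt_sub]
      linear_combination b_one_mul_jump k ((j : ℕ) + 2) ((q : ℕ) + 2) (t + 1)
    · have hM : bordered (m + 1) (symMat k) (rowAt k t) p 0 = b k 1 ((p : ℕ) + 2) := by
        rw [bordered, Matrix.updateRow_ne hp]
        exact symMat_zero_right k p
      rw [hM]
      exact b_one_mul_symMat_sub k p hjq

/-! ### The determinants `c(m)_i` -/

theorem cShift_add_two (m : ℕ) (i : ℤ) :
    cShift k (m + 2) i = (bordered m (symMat k) (rowAt k (m + 1 + i))).det := by
  refine congrArg (Matrix.det (n := Fin (m + 1))) ?_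
  ext p q
  have hp : p = Fin.last m ↔ (p : ℕ) + 1 = m + 2 - 1 := by
    rw [Fin.ext_iff, Fin.val_last]
    omega
  simp only [bordered, Matrix.updateRow_apply, hp, matCShift, Matrix.of_apply]
  split_ifs
  · rw [rowAt]
    push_cast
    congr 1
    ring
  · rfl

theorem bordered_rowAt_of_le {m p : ℕ} (h : m ≤ p) :
    bordered m (symMat k) (rowAt k (p + 1)) = bordered m (symMat k) (symMat k p) := by
  rw [bordered, bordered]
  congr 1
  ext q
  exact (symMat_eq_rowAt k ((Fin.is_le q).trans h)).symm

theorem c_add_two (m : ℕ) : c k (m + 2) = (leading (m + 1) (symMat k)).det := by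
  rw [c, cShift_add_two, add_zero, bordered_rowAt_of_le k le_rfl, bordered_self]

theorem cShift_add_two_one (m : ℕ) :
    cShift k (m + 2) 1 = (bordered m (symMat k) (symMat k (m + 1))).det := by
  rw [cShift_add_two, ← bordered_rowAt_of_le k (Nat.le_succ m)]
  push_cast
  rfl

end SturmB

theorem mainTheorem3 (k : Type*) [CommRing k] (n : ℕ) (hn : 3 ≤ n) (i : ℤ) :
    SturmB.cShift k (n - 1) i * SturmB.c k n ^ 2
      - SturmB.c k (n - 1) * SturmB.c k n * SturmB.cShift k n i
      - SturmB.cShift k (n - 1) 1 * SturmB.cShift k n (i - 1) * SturmB.c k n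
      + SturmB.c k (n - 1) * SturmB.cShift k n 1 * SturmB.cShift k n (i - 1)
    = -(SturmB.c k (n - 1) ^ 2 * SturmB.cShift k (n + 1) (i - 2)) := by 
  obtain ⟨m, rfl⟩ := Nat.exists_eq_add_of_le' hn
  rw [show m + 3 - 1 = m + 2 from rfl, show m + 3 = m + 1 + 2 from rfl,
    show m + 1 + 2 + 1 = m + 2 + 2 from rfl, SturmB.c_add_two, SturmB.c_add_two,
    SturmB.cShift_add_two_one, SturmB.cShift_add_two_one, SturmB.cShift_add_two,
    SturmB.cShift_add_two, SturmB.cShift_add_two, SturmB.cShift_add_two]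
  -- All four rows are `rowAt t` with `t = m + 1 + i`, or its shift by one.
  push_cast
  rw [show (m : ℤ) + 1 + 1 + i = m + 1 + i + 1 by ring,
    show (m : ℤ) + 1 + 1 + (i - 1) = m + 1 + i by ring,
    show (m : ℤ) + 2 + 1 + (i - 2) = m + 1 + i by ring]
  have h1 := SturmB.det_bordered_succ_mul m (SturmB.symMat k) (SturmB.symMat_comm k)
    (SturmB.rowAt k (m + 1 + i))
  have h2 := SturmB.det_leading_mul_det_bordered m (SturmB.symMat k) (SturmB.rowAt k (m + 1 + i))
  have h3 := SturmB.det_bordered_rowAt_add_one k m (m + 1 + i)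
  linear_combination (SturmB.leading (m + 1) (SturmB.symMat k)).det * h1
    + (SturmB.leading (m + 2) (SturmB.symMat k)).det * h2
    - (SturmB.leading (m + 1) (SturmB.symMat k)).det
      * (SturmB.leading (m + 2) (SturmB.symMat k)).det * h3
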